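/- Work in synthetic differential geometry, interpreted in the topos $\mathcal E$ of sheaves of sets on an arbitrary site; "map", "element", "for all", "exists" are understood in the internal sense (generalized elements at arbitrary stages, existence on a covering). Let $R$ be a commutative ring object of $\mathcal E$ in which every positive integer is invertible. For $k,n\ge 0$ let $D_k(n)\subseteq R^n$ be the set of $d=(d_1,\dots,d_n)$ such that every product of $k+1$ (not necessarily distinct) coordinates of $d$ vanishes. An $R$-module $W$ is called a KL vector space if, for all $k,n$, every map $D_k(n)\to W$ is given by a unique polynomial of degree $\le k$ in $n$ variables with coefficients in $W$. Assume that $R$ itself is a KL vector space. In $R^n$ write $u\sim v$ if $v-u\in D_1(n)$. An $n$-dimensional (formal) manifold is an object $M$ with a jointly epic family of charts $U\to M$, where each $U$ is a formally open subset of $R^n$ (i.e. $u\in U$ and $u\sim v$ imply $v\in U$) and $U\to M$ is monic and formally étale with respect to the infinitesimal objects $D_1(m)$, i.e. for all $m\ge 0$ a map $D_1(m)\to M$ together with a lift to $U$ of its value at $0$ has a unique lift $D_1(m)\to U$ with that value at $0$. For $x,y\in M$ write $x\sim y$ ($x$ and $y$ are neighbours) if $x,y$ are the images, under some chart $U\to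 M$ of the family, of points $u,v\in U$ with $u\sim v$; let $M_{(1)}=\{(x,y)\in M\times M: x\sim y\}$. Let $G=(G,*)$ be a group object which is a matrix group in the following sense: there is an associative unitary (not necessarily commutative) $R$-algebra $W$, which is a KL vector space, and a monomorphism of $G$ into the multiplicative monoid of $W$. A $G$-valued 1-form on $M$ is a map $\omega:M_{(1)}\to G$ with $\omega(x,x)=1$ and $\omega(y,x)=\omega(x,y)^{-1}$; it is closed if $\omega(x,y)*\omega(y,z)=\omega(x,z)$ whenever $x,y,z$ are mutual neighbours. For $l\ge 0$, an $l$-path in $M$ is a tuple $\underline x=(x_0,\dots,x_l)$ of points of $M$ with $x_{i}\sim x_{i+1}$ for $0\le i<l$; its domain is $x_0$, its codomain is $x_l$, and $$\int_{\underline x}\omega:=\omega(x_0,x_1)*\omega(x_1,x_2)*\cdots*\omega(x_{l-1},x_l)$$ (equal to $1$ if $l=0$). **Proposition.** Let $\omega$ be a closed $G$-valued 1-form on a manifold $M$, where $G$ is a matrix group. Then $\int_{\underline x}\omega$ depends only on the domain and the codomain of the path $\underline x$: if $\underline x$ is an $l$-path and $\underline y$ is an $m$-path (at the same stage) with $x_0=y_0$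 and $x_l=y_m$, then $\int_{\underline x}\omega=\int_{\underline y}\omega$. -/

import Mathlib

/-!
Synthetic differential geometry inside the topos of sheaves of sets on an arbitrary site `(C, J)`.

An object of the topos is a sheaf `X : Sheaf J (Type w)`. An element of `X.obj.obj c` is a
generalized element of `X` at stage `c : Cᵒᵖ`, and `X.obj.map h x` is its restriction along a
change of stage `h : c ⟶ d`. Statements of the internal language are read by the usual sheaf
semantics: a universally quantified statement has to hold at all (later) stages, and an
existence statement or a disjunction has to hold on a covering of the given stage.

No smallness is required of `C`, so an elementary topos with its canonical topology is covered.
-/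

open CategoryTheory Opposite

universe v u w t

namespace SDG

section Basic

variable {C : Type u} [Category.{v} C]

/-- An element at stage `c` of the internal function object from `X` to `Y`: a function from the
elements of `X` to the elements of `Y`, at all stages `d` over `c`, compatible with change of
stage. -/
structure InternalMap (X Y : Cᵒᵖ ⥤ Type w) (c : Cᵒᵖ) where
  app : ∀ {d : Cᵒᵖ}, (c ⟶ d) → X.obj d → Y.obj d
  naturality : ∀ {d e : Cᵒᵖ} (h : c ⟶ d) (g : d ⟶ e) (x : X.obj d),
    app (h ≫ g) (X.map g x) = Y.map g (app h x)

/-- A commutative ring object in the topos of sheaves on `(C, J)`. -/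
structure RingObject (J : GrothendieckTopology C) where
  carrier : Sheaf J (Type w)
  commRing : ∀ c, CommRing (carrier.obj.obj c)
  map_one : ∀ {c d : Cᵒᵖ} (h : c ⟶ d), carrier.obj.map h 1 = 1
  map_add : ∀ {c d : Cᵒᵖ} (h : c ⟶ d) (r s : carrier.obj.obj c),
    carrier.obj.map h (r + s) = carrier.obj.map h r + carrier.obj.map h s
  map_mul : ∀ {c d : Cᵒᵖ} (h : c ⟶ d) (r s : carrier.obj.obj c),
    carrier.obj.map h (r * s) = carrier.obj.map h r * carrier.obj.map h s

/-- A (not necessarily commutative) group object in the topos of sheaves on `(C, J)`. -/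
structure GroupObject (J : GrothendieckTopology C) where
  carrier : Sheaf J (Type w)
  group : ∀ c, Group (carrier.obj.obj c)
  map_mul : ∀ {c d : Cᵒᵖ} (h : c ⟶ d) (a b : carrier.obj.obj c),
    carrier.obj.map h (a * b) = carrier.obj.map h a * carrier.obj.map h b

attribute [instance] RingObject.commRing GroupObject.group

variable {J : GrothendieckTopology C}

theorem RingObject.map_zero (R : RingObject.{v, u, w} J) {c d : Cᵒᵖ} (h : c ⟶ d) :
    R.carrier.obj.map h 0 = 0 := by
  have := R.map_add h 0 0
  simpa using this

theorem RingObject.map_prod (R : RingObject.{v, u, w} J) {c d : Cᵒᵖ} (h : c ⟶ d)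
    {ι : Type} (s : Finset ι) (f : ι → R.carrier.obj.obj c) :
    R.carrier.obj.map h (∏ i ∈ s, f i) = ∏ i ∈ s, R.carrier.obj.map h (f i) := by
  classical
  induction s using Finset.induction_on with
  | empty => simpa using R.map_one h
  | insert a s ha ih => rw [Finset.prod_insert ha, Finset.prod_insert ha, R.map_mul, ih]

/-- A vector space, that is, an `R`-module object. -/
structure ModuleObject (R : RingObject.{v, u, w} J) where
  carrier : Sheaf J (Type w)
  addCommGroup : ∀ c, AddCommGroup (carrier.obj.obj c)
  module : ∀ c, Module (R.carrier.obj.obj c) (carrier.obj.obj c)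
  map_add : ∀ {c d : Cᵒᵖ} (h : c ⟶ d) (a b : carrier.obj.obj c),
    carrier.obj.map h (a + b) = carrier.obj.map h a + carrier.obj.map h b
  map_smul : ∀ {c d : Cᵒᵖ} (h : c ⟶ d) (r : R.carrier.obj.obj c) (a : carrier.obj.obj c),
    carrier.obj.map h (r • a) = R.carrier.obj.map h r • carrier.obj.map h a

/-- An associative unitary (not necessarily commutative) `R`-algebra object. -/
structure AlgebraObject (R : RingObject.{v, u, w} J) where
  carrier : Sheaf J (Type w)
  ring : ∀ c, Ring (carrier.obj.obj c)
  algebra : ∀ c, Algebra (R.carrier.obj.obj c) (carrier.obj.obj c)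
  map_one : ∀ {c d : Cᵒᵖ} (h : c ⟶ d), carrier.obj.map h 1 = 1
  map_add : ∀ {c d : Cᵒᵖ} (h : c ⟶ d) (a b : carrier.obj.obj c),
    carrier.obj.map h (a + b) = carrier.obj.map h a + carrier.obj.map h b
  map_mul : ∀ {c d : Cᵒᵖ} (h : c ⟶ d) (a b : carrier.obj.obj c),
    carrier.obj.map h (a * b) = carrier.obj.map h a * carrier.obj.map h b
  map_smul : ∀ {c d : Cᵒᵖ} (h : c ⟶ d) (r : R.carrier.obj.obj c) (a : carrier.obj.obj c),
    carrier.obj.map h (r • a) = R.carrier.obj.map h r • carrier.obj.map h a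

attribute [instance] ModuleObject.addCommGroup ModuleObject.module
  AlgebraObject.ring AlgebraObject.algebra

/-- The underlying vector space of an algebra. -/
def AlgebraObject.toModuleObject {R : RingObject.{v, u, w} J} (W : AlgebraObject R) :
    ModuleObject R where
  carrier := W.carrier
  addCommGroup _ := inferInstance
  module _ := inferInstance
  map_add := W.map_add
  map_smul := W.map_smul

/-- The ring `R` as a vector space over itself. -/
def RingObject.selfModule (R : RingObject.{v, u, w} J) : ModuleObject R where
  carrier := R.carrier
  addCommGroup _ := inferInstance
  module _ := inferInstance
  map_add := R.map_add
  map_smul := R.map_mul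

/-- Membership in `D_k(n) ⊆ R ^ n`: all products of `k + 1` of the coordinates (repetitions
allowed) vanish. -/
def MemD (R : RingObject.{v, u, w} J) (k n : ℕ) {c : Cᵒᵖ} (d : Fin n → R.carrier.obj.obj c) :
    Prop :=
  ∀ s : Fin (k + 1) → Fin n, ∏ j, d (s j) = 0

theorem MemD.map {R : RingObject.{v, u, w} J} {k n : ℕ} {c e : Cᵒᵖ} (h : c ⟶ e)
    {d : Fin n → R.carrier.obj.obj c} (hd : MemD R k n d) :
    MemD R k n (fun i => R.carrier.obj.map h (d i)) := fun s => by
  rw [← R.map_prod h, hd s, R.map_zero]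

theorem memD_zero (R : RingObject.{v, u, w} J) (k n : ℕ) (c : Cᵒᵖ) :
    MemD R k n (fun _ => (0 : R.carrier.obj.obj c)) := fun s => by simp

/-- The object `D_k(n)` of the topos. -/
def D (R : RingObject.{v, u, w} J) (k n : ℕ) : Cᵒᵖ ⥤ Type w where
  obj c := {d : Fin n → R.carrier.obj.obj c // MemD R k n d}
  map h := ↾fun d => ⟨fun i => R.carrier.obj.map h (d.1 i), d.2.map h⟩
  map_id c := by ext d; simp
  map_comp f g := by ext d; simp

/-- The base point `0` of `D_k(n)`. -/
def D.zero (R : RingObject.{v, u, w} J) (k n : ℕ) (c : Cᵒᵖ) : (D R k n).obj c :=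
  ⟨fun _ => 0, memD_zero R k n c⟩

/-- Exponents of the monomials of degree at most `k` in `n` variables. -/
abbrev Exponent (k n : ℕ) : Type := {α : Fin n → Fin (k + 1) // ∑ i, (α i : ℕ) ≤ k}

/-- `W` is a KL vector space (Kock-Lawvere axiom): every map `D_k(n) → W` is given by a unique
polynomial of degree at most `k` with coefficients in `W`. The map may be an element of the
function object at an arbitrary stage. -/
def ModuleObject.IsKL {R : RingObject.{v, u, w} J} (W : ModuleObject R) : Prop :=
  ∀ (k n : ℕ) (c : Cᵒᵖ) (f : InternalMap (D R k n) W.carrier.obj c),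
    ∃! a : Exponent k n → W.carrier.obj.obj c,
      ∀ {e : Cᵒᵖ} (h : c ⟶ e) (d : (D R k n).obj e),
        f.app h d = ∑ α, (∏ i, d.1 i ^ (α.1 i : ℕ)) • W.carrier.obj.map h (a α)

/-- `R` is a number line: it satisfies the Kock-Lawvere axiom and contains the rational
numbers. -/
structure RingObject.IsLine (R : RingObject.{v, u, w} J) : Prop where
  kl : R.selfModule.IsKL
  isUnit_natCast : ∀ (c : Cᵒᵖ) (m : ℕ), m ≠ 0 → IsUnit (m : R.carrier.obj.obj c)

/-- `G` is (isomorphic to) a matrix group: there is an associative unitary algebra `W` which is a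
KL vector space, and a monomorphism from `G` into the multiplicative monoid of `W`. -/
def GroupObject.IsMatrixGroup (R : RingObject.{v, u, w} J) (G : GroupObject.{v, u, w} J) : Prop :=
  ∃ (W : AlgebraObject R) (j : ∀ c, G.carrier.obj.obj c →* W.carrier.obj.obj c),
    W.toModuleObject.IsKL ∧
    (∀ {c d : Cᵒᵖ} (h : c ⟶ d) (g : G.carrier.obj.obj c),
      j d (G.carrier.obj.map h g) = W.carrier.obj.map h (j c g)) ∧
    ∀ c, Function.Injective (j c)

/-- A map `f : X ⟶ Y` is formally étale with respect to the infinitesimal objects `D_1(m)`: every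
`g : D_1(m) → Y` together with a lift `x` of `g 0` has a unique lift to `D_1(m) → X` with
value `x` at `0`. For a map that is formally étale with respect to all infinitesimal objects
this is in particular true. -/
def FormallyEtale (R : RingObject.{v, u, w} J) {X Y : Sheaf J (Type w)} (f : X ⟶ Y) : Prop :=
  ∀ (m : ℕ) (c : Cᵒᵖ) (x : X.obj.obj c) (g : InternalMap (D R 1 m) Y.obj c),
    g.app (𝟙 c) (D.zero R 1 m c) = f.hom.app c x →
    ∃! l : InternalMap (D R 1 m) X.obj c,
      l.app (𝟙 c) (D.zero R 1 m c) = x ∧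
      ∀ {e : Cᵒᵖ} (h : c ⟶ e) (d : (D R 1 m).obj e), f.hom.app e (l.app h d) = g.app h d

/-- An `n`-dimensional chart `U → M`: `U` is (by means of `coord`) a formally open subset of
`R ^ n`, that is, one which is closed under the first order neighbour relation of `R ^ n`, and
`param : U ⟶ M` is a formally étale monomorphism. -/
structure Chart (R : RingObject.{v, u, w} J) (n : ℕ) (M : Sheaf J (Type w)) where
  dom : Sheaf J (Type w)
  coord : ∀ {c : Cᵒᵖ}, dom.obj.obj c → Fin n → R.carrier.obj.obj c
  coord_map : ∀ {c d : Cᵒᵖ} (h : c ⟶ d) (p : dom.obj.obj c) (i : Fin n),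
    coord (dom.obj.map h p) i = R.carrier.obj.map h (coord p i)
  coord_injective : ∀ c : Cᵒᵖ, Function.Injective (coord (c := c))
  formallyOpen : ∀ {c : Cᵒᵖ} (p : dom.obj.obj c) (y : Fin n → R.carrier.obj.obj c),
    MemD R 1 n (y - coord p) → ∃ q : dom.obj.obj c, coord q = y
  param : dom ⟶ M
  param_injective : ∀ c : Cᵒᵖ, Function.Injective (param.hom.app c)
  param_etale : FormallyEtale R param

/-- An `n`-dimensional formal manifold: an object with a jointly epic family of charts. -/
structure Manifold (R : RingObject.{v, u, w} J) (n : ℕ) where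
  carrier : Sheaf J (Type w)
  index : Type t
  chart : index → Chart R n carrier
  jointly_epic : ∀ (c : Cᵒᵖ) (x : carrier.obj.obj c), ∃ S ∈ J c.unop,
    ∀ {d : Cᵒᵖ} (h : c ⟶ d), S h.unop → ∃ (i : index) (p : (chart i).dom.obj.obj d),
      (chart i).param.hom.app d p = carrier.obj.map h x

namespace Manifold

variable {R : RingObject.{v, u, w} J} {n : ℕ} (M : Manifold.{v, u, w, t} R n)

/-- The (first order) neighbour relation `x ∼ y` of a manifold: (locally) `x` and `y` are the
images under a chart of points whose coordinates differ by an element of `D_1(n)`. -/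
def Neighbour {c : Cᵒᵖ} (x y : M.carrier.obj.obj c) : Prop :=
  ∃ S ∈ J c.unop, ∀ {d : Cᵒᵖ} (h : c ⟶ d), S h.unop →
    ∃ (i : M.index) (p q : (M.chart i).dom.obj.obj d),
      (M.chart i).param.hom.app d p = M.carrier.obj.map h x ∧
      (M.chart i).param.hom.app d q = M.carrier.obj.map h y ∧
      MemD R 1 n ((M.chart i).coord q - (M.chart i).coord p)

variable {M}

theorem Neighbour.map {c d : Cᵒᵖ} (h : c ⟶ d) {x y : M.carrier.obj.obj c}
    (hxy : M.Neighbour x y) :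
    M.Neighbour (M.carrier.obj.map h x) (M.carrier.obj.map h y) := by
  obtain ⟨S, hS, H⟩ := hxy
  refine ⟨S.pullback h.unop, J.pullback_stable _ hS, fun {e} g hg => ?_⟩
  obtain ⟨i, p, q, hp, hq, hpq⟩ := H (h ≫ g) hg
  exact ⟨i, p, q, by simpa using hp, by simpa using hq, hpq⟩

theorem Neighbour.refl {c : Cᵒᵖ} (x : M.carrier.obj.obj c) : M.Neighbour x x := by
  obtain ⟨S, hS, H⟩ := M.jointly_epic c x
  refine ⟨S, hS, fun {d} h hh => ?_⟩
  obtain ⟨i, p, hp⟩ := H h hh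
  refine ⟨i, p, p, hp, hp, ?_⟩
  rw [sub_self]
  exact memD_zero R 1 n d

theorem Neighbour.symm {c : Cᵒᵖ} {x y : M.carrier.obj.obj c} (hxy : M.Neighbour x y) :
    M.Neighbour y x := by
  obtain ⟨S, hS, H⟩ := hxy
  refine ⟨S, hS, fun {d} h hh => ?_⟩
  obtain ⟨i, p, q, hp, hq, hpq⟩ := H h hh
  refine ⟨i, q, p, hq, hp, fun s => ?_⟩
  have := hpq s
  simp only [Fin.prod_univ_succ, Fin.prod_univ_zero, Pi.sub_apply] at this ⊢
  linear_combination this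

variable (M)

/-- The first neighbourhood of the diagonal `M_(1) ⊆ M × M`. -/
def firstNeighbourhood : Cᵒᵖ ⥤ Type w where
  obj c := {z : M.carrier.obj.obj c × M.carrier.obj.obj c // M.Neighbour z.1 z.2}
  map h := ↾fun z => ⟨(M.carrier.obj.map h z.1.1, M.carrier.obj.map h z.1.2), z.2.map h⟩
  map_id c := by ext z <;> simp
  map_comp f g := by ext z <;> simp

/-- A `G`-valued 1-form on `M`: a map `ω : M_(1) → G` with `ω(x, x) = 1` and
`ω(y, x) = ω(x, y)⁻¹`. -/
structure OneForm (G : GroupObject.{v, u, w} J) where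
  toHom : M.firstNeighbourhood ⟶ G.carrier.obj
  app_self : ∀ {c : Cᵒᵖ} (x : M.carrier.obj.obj c),
    toHom.app c ⟨(x, x), Neighbour.refl x⟩ = (1 : G.carrier.obj.obj c)
  app_symm : ∀ {c : Cᵒᵖ} (x y : M.carrier.obj.obj c) (h : M.Neighbour x y),
    toHom.app c ⟨(y, x), h.symm⟩ =
      (show G.carrier.obj.obj c from toHom.app c ⟨(x, y), h⟩)⁻¹

variable {M}

/-- The value `ω(x, y)` for neighbours `x ∼ y`. -/
def OneForm.val {G : GroupObject.{v, u, w} J} (ω : M.OneForm G) {c : Cᵒᵖ}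
    (x y : M.carrier.obj.obj c) (h : M.Neighbour x y) : G.carrier.obj.obj c :=
  ω.toHom.app c ⟨(x, y), h⟩

/-- `ω` is closed: `ω(x, y) * ω(y, z) = ω(x, z)` for mutual neighbours `x, y, z`. -/
def OneForm.IsClosed {G : GroupObject.{v, u, w} J} (ω : M.OneForm G) : Prop :=
  ∀ {c : Cᵒᵖ} (x y z : M.carrier.obj.obj c) (hxy : M.Neighbour x y) (hyz : M.Neighbour y z)
    (hxz : M.Neighbour x z), ω.val x y hxy * ω.val y z hyz = ω.val x z hxz

variable (M)

/-- An `l`-path in `M` (at stage `c`): `l + 1` points, each a neighbour of the next. -/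
structure Path (l : ℕ) (c : Cᵒᵖ) where
  point : Fin (l + 1) → M.carrier.obj.obj c
  neighbour : ∀ i : Fin l, M.Neighbour (point i.castSucc) (point i.succ)

variable {M}

/-- The first point of a path. -/
def Path.domain {l : ℕ} {c : Cᵒᵖ} (x : M.Path l c) : M.carrier.obj.obj c := x.point 0

/-- The last point of a path. -/
def Path.codomain {l : ℕ} {c : Cᵒᵖ} (x : M.Path l c) : M.carrier.obj.obj c :=
  x.point (Fin.last l)

/-- The path integral `ω(x₀, x₁) * ω(x₁, x₂) * ⋯ * ω(x_{l-1}, x_l)`. -/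
def OneForm.integral {G : GroupObject.{v, u, w} J} (ω : M.OneForm G) {l : ℕ} {c : Cᵒᵖ}
    (x : M.Path l c) : G.carrier.obj.obj c :=
  (List.ofFn fun i : Fin l => ω.val (x.point i.castSucc) (x.point i.succ) (x.neighbour i)).prod

end Manifold

end Basic

end SDG

/-! Equality in `G` is local, so the common starting point may be assumed to lie in a chart `U`, at
a point `p`. By formal étaleness every neighbour of a point of `U` lies again in `U` and differs
from it by an element of `D_1(n)` in these coordinates. Hence a whole path lies in `U` and is
recorded by a list of displacements `d₁, …, d_l`. It remains to see that the integral depends only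
on their sum.

Embed `G` in `W` and let `τ_d` act on functions `g : U → W` by `(τ_d g)(p) = ω(p, p + d) * g(p +
d)`. The path integral is `(τ_{d₁} ⋯ τ_{d_l} 1)(p)`. By the Kock-Lawvere axiom `τ_d = 1 + t_d` with
`t_d = ∑ d_j ∂_j`, where the `∂_j` are linear operators (covariant derivatives), and `t_d² = 0`
because `d_i d_j = 0`.

Closedness says that the curvature vanishes: `∂_i ∂_j 1 = ∂_j ∂_i 1` (`deriv_deriv_comm`). This
makes the `τ_d` commute for arbitrary `d, f ∈ D_1(n)`, not only for mutual neighbours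
(`translate_commute`). Over the rationals a product of commuting `1 + t_d` with `t_d² = 0` is `exp
(∑ t_d)`, and `∑ t_d` involves the displacements only through their sum (`prod_translate_eq`). -/

namespace SDG

/-! ### Exponentials of commuting square-zero elements -/

/-- A commutative ring in which all positive integers are invertible is a `ℚ`-algebra. -/
theorem nonempty_algebra_rat {A : Type*} [CommRing A] (h : ∀ m : ℕ, m ≠ 0 → IsUnit (m : A)) :
    Nonempty (Algebra ℚ A) := by
  -- The criterion asks that every quotient by a proper ideal have characteristic zero.
  refine (EqualCharZero.nonempty_algebraRat_iff A).2 fun I hI => ?_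
  have : Nontrivial (A ⧸ I) := Ideal.Quotient.nontrivial_iff.2 hI
  refine charZero_of_inj_zero fun m hm => ?_
  by_contra hm0
  have hu := (h m hm0).map (Ideal.Quotient.mk I)
  rw [map_natCast, hm] at hu
  exact not_isUnit_zero hu

/-- A product of commuting elements `1 + a` with `a ^ 2 = 0` is the exponential of the sum
of the `a`. -/
theorem prod_one_add_eq_exp {A ι : Type*} [Ring A] [Module ℚ A] (f : ι → A)
    (hsq : ∀ i, f i * f i = 0) (hcomm : ∀ i j, Commute (f i) (f j)) (L : List ι) :
    IsNilpotent (L.map f).sum ∧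
      (L.map fun i => 1 + f i).prod = IsNilpotent.exp (L.map f).sum := by
  induction L with
  | nil => exact ⟨by simp, by simp [IsNilpotent.exp_zero]⟩
  | cons a L ih =>
    have hc : Commute (f a) (L.map f).sum := by
      refine Commute.list_sum_right _ _ fun b hb => ?_
      obtain ⟨i, -, rfl⟩ := List.mem_map.1 hb
      exact hcomm a i
    have ha : IsNilpotent (f a) := ⟨2, by rw [pow_two, hsq]⟩
    have he : IsNilpotent.exp (f a) = 1 + f a := by
      rw [IsNilpotent.exp_eq_sum (k := 2) (by rw [pow_two, hsq])]
      simp [Finset.sum_range_succ]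
    simp only [List.map_cons, List.sum_cons, List.prod_cons]
    exact ⟨hc.isNilpotent_add ha ih.1, by
      rw [IsNilpotent.exp_add_of_commute hc ha ih.1, ih.2, he]⟩

/-! ### Polynomials of degree at most one -/

section Exponent

variable {n : ℕ}

/-- The monomials of degree at most one: `1` and the variables. -/
def linearExponent (n : ℕ) : Option (Fin n) → Exponent 1 n
  | none => ⟨fun _ => 0, by simp⟩
  | some j => ⟨Pi.single j 1, by
      rw [Finset.sum_eq_single j] <;> simp +contextual⟩

theorem linearExponent_bijective (n : ℕ) : Function.Bijective (linearExponent n) := by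
  constructor
  · rintro (_ | i) (_ | j) h
    · rfl
    · have := congrFun (congrArg Subtype.val h) j
      simp [linearExponent] at this
    · have := congrFun (congrArg Subtype.val h) i
      simp [linearExponent] at this
    · have := congrFun (congrArg Subtype.val h) i
      by_cases hij : i = j
      · rw [hij]
      · simp [linearExponent, hij] at this
  · rintro ⟨α, hα⟩
    by_cases h0 : ∀ i, α i = 0
    · exact ⟨none, Subtype.ext (funext fun i => (h0 i).symm)⟩
    · push Not at h0
      obtain ⟨j, hj⟩ := h0
      have hj' : (α j : ℕ) ≠ 0 := fun h => hj (Fin.ext h)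
      have hj2 := (α j).2
      refine ⟨some j, Subtype.ext (funext fun i => ?_)⟩
      by_cases hij : i = j
      · subst hij
        refine Fin.ext ?_
        simp only [linearExponent, Pi.single_eq_same, Fin.val_one]
        omega
      · have h2 : ((α i : ℕ) + (α j : ℕ)) ≤ ∑ i, (α i : ℕ) := by
          rw [← Finset.sum_pair (f := fun i => (α i : ℕ)) hij]
          exact Finset.sum_le_sum_of_subset (Finset.subset_univ _)
        refine Fin.ext ?_
        simp only [linearExponent, Pi.single_apply, hij, if_false, Fin.val_zero]
        omega

/-- Rewrites the general Kock-Lawvere polynomial for `k = 1` as constant term plus linear part. -/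
theorem sum_exponent_one {A V : Type*} [CommRing A] [AddCommGroup V] [Module A V]
    (d : Fin n → A) (a : Exponent 1 n → V) :
    ∑ α, (∏ i, d i ^ (α.1 i : ℕ)) • a α =
      a (linearExponent n none) + ∑ j, d j • a (linearExponent n (some j)) := by
  rw [← (linearExponent_bijective n).sum_comp, Fintype.sum_option]
  congr 1
  · simp [linearExponent]
  · refine Finset.sum_congr rfl fun j _ => ?_
    congr 1
    rw [Finset.prod_eq_single j] <;> simp +contextual [linearExponent]

end Exponent

variable {C : Type u} [Category.{v} C] {J : GrothendieckTopology C}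

/-! ### Local equality and gluing -/

section Sheaf

theorem sheaf_ext (X : Sheaf J (Type w)) {c : Cᵒᵖ} {S : Sieve c.unop} (hS : S ∈ J c.unop)
    {a b : X.obj.obj c}
    (h : ∀ {d : Cᵒᵖ} (f : c ⟶ d), S f.unop → X.obj.map f a = X.obj.map f b) : a = b :=
  (X.property.isSheafFor S hS).isSeparatedFor.ext fun _ f hf => h f.op hf

/-- Unique existence is local. -/
theorem exists_of_locally_existsUnique (X : Sheaf J (Type w)) {c : Cᵒᵖ} {S : Sieve c.unop}
    (hS : S ∈ J c.unop) (P : ∀ {d : Cᵒᵖ}, (c ⟶ d) → X.obj.obj d → Prop)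
    (hP : ∀ {d e : Cᵒᵖ} (f : c ⟶ d) (g : d ⟶ e) (a : X.obj.obj d),
      P f a → P (f ≫ g) (X.obj.map g a))
    (huniq : ∀ {d : Cᵒᵖ} (f : c ⟶ d) (a b : X.obj.obj d), P f a → P f b → a = b)
    (hex : ∀ {d : Cᵒᵖ} (f : c ⟶ d), S f.unop → ∃ a, P f a) :
    ∃ a : X.obj.obj c, ∀ {d : Cᵒᵖ} (f : c ⟶ d), S f.unop → P f (X.obj.map f a) := by
  choose a ha using @hex
  let x : Presieve.FamilyOfElements X.obj S.arrows := fun Y f hf => a f.op hf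
  have hx : x.Compatible := by
    rw [Presieve.compatible_iff_sieveCompatible]
    intro Y Z f g hf
    -- Uniqueness forces the local witnesses to agree on overlaps, so they glue.
    exact huniq _ _ _ (ha _ _) (hP f.op g.op _ (ha _ _))
  refine ⟨(X.property.isSheafFor S hS).amalgamate x hx, fun {d} f hf => ?_⟩
  have := (X.property.isSheafFor S hS).valid_glue hx f.unop hf
  rw [Quiver.Hom.op_unop] at this
  rw [this]
  exact ha f hf

end Sheaf

theorem memD_one_iff {R : RingObject.{v, u, w} J} {n : ℕ} {c : Cᵒᵖ}
    {d : Fin n → R.carrier.obj.obj c} : MemD R 1 n d ↔ ∀ i j, d i * d j = 0 := by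
  constructor
  · intro h i j
    simpa [Fin.prod_univ_succ] using h ![i, j]
  · intro h s
    simpa [Fin.prod_univ_succ] using h (s 0) (s 1)

theorem RingObject.map_neg (R : RingObject.{v, u, w} J) {c d : Cᵒᵖ} (h : c ⟶ d)
    (a : R.carrier.obj.obj c) : R.carrier.obj.map h (-a) = -R.carrier.obj.map h a :=
  eq_neg_of_add_eq_zero_left (by rw [← R.map_add, neg_add_cancel, R.map_zero])

theorem RingObject.map_sub (R : RingObject.{v, u, w} J) {c d : Cᵒᵖ} (h : c ⟶ d)
    (a b : R.carrier.obj.obj c) :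
    R.carrier.obj.map h (a - b) = R.carrier.obj.map h a - R.carrier.obj.map h b := by
  rw [sub_eq_add_neg, R.map_add, R.map_neg, sub_eq_add_neg]

theorem D.map_val {R : RingObject.{v, u, w} J} {k n : ℕ} {c d : Cᵒᵖ} (h : c ⟶ d)
    (x : (D R k n).obj c) (i : Fin n) :
    ((D R k n).map h x).1 i = R.carrier.obj.map h (x.1 i) := rfl

/-! ### First-order consequences of the Kock-Lawvere axiom -/

namespace ModuleObject

variable {R : RingObject.{v, u, w} J} (V : ModuleObject R)

theorem map_zero {c d : Cᵒᵖ} (h : c ⟶ d) : V.carrier.obj.map h 0 = 0 := by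
  have := V.map_add h 0 0
  simpa using this

theorem map_neg {c d : Cᵒᵖ} (h : c ⟶ d) (a : V.carrier.obj.obj c) :
    V.carrier.obj.map h (-a) = -V.carrier.obj.map h a :=
  eq_neg_of_add_eq_zero_left (by rw [← V.map_add, neg_add_cancel, V.map_zero])

theorem map_sub {c d : Cᵒᵖ} (h : c ⟶ d) (a b : V.carrier.obj.obj c) :
    V.carrier.obj.map h (a - b) = V.carrier.obj.map h a - V.carrier.obj.map h b := by
  rw [sub_eq_add_neg, V.map_add, V.map_neg, sub_eq_add_neg]

theorem map_sum {c d : Cᵒᵖ} (h : c ⟶ d) {ι : Type} (s : Finset ι)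
    (f : ι → V.carrier.obj.obj c) :
    V.carrier.obj.map h (∑ i ∈ s, f i) = ∑ i ∈ s, V.carrier.obj.map h (f i) := by
  classical
  induction s using Finset.induction_on with
  | empty => simpa using V.map_zero h
  | insert a s ha ih => rw [Finset.sum_insert ha, Finset.sum_insert ha, V.map_add, ih]

variable {V}

/-- Maps `D_1(n) → V` are uniquely of the form `d ↦ a + ∑ j, d j • b j`. -/
theorem IsKL.linear (hV : V.IsKL) {n : ℕ} {c : Cᵒᵖ} (f : InternalMap (D R 1 n) V.carrier.obj c) :
    ∃ b : Fin n → V.carrier.obj.obj c, ∀ {e : Cᵒᵖ} (h : c ⟶ e) (d : (D R 1 n).obj e),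
      f.app h d = V.carrier.obj.map h (f.app (𝟙 c) (D.zero R 1 n c)) +
        ∑ j, d.1 j • V.carrier.obj.map h (b j) := by
  obtain ⟨a, ha, -⟩ := hV 1 n c f
  refine ⟨fun j => a (linearExponent n (some j)), fun {e} h d => ?_⟩
  -- Evaluation at `0` identifies the constant coefficient.
  have h0 := ha (𝟙 c) (D.zero R 1 n c)
  rw [sum_exponent_one] at h0
  rw [ha, sum_exponent_one, h0]
  simp [D.zero]

/-- Both coefficient systems represent the same map on `D_1(n)`, so the uniqueness half of the axiom
applies. The agreement is required at all later stages. -/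
theorem IsKL.linear_unique (hV : V.IsKL) {n : ℕ} {c : Cᵒᵖ}
    (a a' : V.carrier.obj.obj c) (b b' : Fin n → V.carrier.obj.obj c)
    (H : ∀ {e : Cᵒᵖ} (h : c ⟶ e) (d : (D R 1 n).obj e),
      V.carrier.obj.map h a + ∑ j, d.1 j • V.carrier.obj.map h (b j) =
      V.carrier.obj.map h a' + ∑ j, d.1 j • V.carrier.obj.map h (b' j)) : b = b' := by
  let E := Equiv.ofBijective _ (linearExponent_bijective n)
  have hE : ∀ o, E.symm (linearExponent n o) = o := fun o => E.symm_apply_apply o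
  let f : InternalMap (D R 1 n) V.carrier.obj c :=
    { app := fun {e} h d => V.carrier.obj.map h a + ∑ j, d.1 j • V.carrier.obj.map h (b j)
      naturality := fun {d e} h g x => by
        simp [V.map_add, V.map_sum, V.map_smul, D.map_val] }
  have key := (hV 1 n c f).unique (y₁ := fun α => Option.elim (E.symm α) a b)
    (y₂ := fun α => Option.elim (E.symm α) a' b')
    (fun h d => by rw [sum_exponent_one]; simp only [hE]; rfl)
    (fun h d => by rw [sum_exponent_one]; simp only [hE]; exact H h d)
  funext j
  have := congrFun key (linearExponent n (some j))
  simp only [hE] at this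
  exact this

/-- Universally quantified elements of square zero can be cancelled. -/
theorem IsKL.cancel (hV : V.IsKL) {c : Cᵒᵖ} (a : V.carrier.obj.obj c)
    (H : ∀ {e : Cᵒᵖ} (h : c ⟶ e) (s : R.carrier.obj.obj e), s * s = 0 →
      s • V.carrier.obj.map h a = 0) : a = 0 := by
  have := hV.linear_unique (n := 1) (0 : V.carrier.obj.obj c) 0 (fun _ => a) (fun _ => 0)
    (fun h d => by
      have := H h (d.1 0) (memD_one_iff.1 d.2 0 0)
      simp [V.map_zero, this])
  exact congrFun this 0

end ModuleObject

end SDG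

/-! ### Charts absorb neighbours -/

namespace SDG

variable {C : Type u} [Category.{v} C] {J : GrothendieckTopology C}

theorem RingObject.IsLine.linear {R : RingObject.{v, u, w} J} (hR : R.IsLine) {n : ℕ} {c : Cᵒᵖ}
    (f : InternalMap (D R 1 n) R.carrier.obj c) :
    ∃ b : Fin n → R.carrier.obj.obj c, ∀ d : (D R 1 n).obj c,
      f.app (𝟙 c) d = f.app (𝟙 c) (D.zero R 1 n c) + ∑ j, d.1 j * b j := by
  obtain ⟨b, hb⟩ := ModuleObject.IsKL.linear hR.kl f
  refine ⟨b, fun d => (hb (𝟙 c) d).trans ?_⟩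
  simp only [CategoryTheory.Functor.map_id, types_id_apply]
  rfl

namespace Chart

variable {R : RingObject.{v, u, w} J} {n : ℕ} {M : Sheaf J (Type w)} (T : Chart R n M)

theorem param_map {c d : Cᵒᵖ} (h : c ⟶ d) (p : T.dom.obj.obj c) :
    T.param.hom.app d (T.dom.obj.map h p) = M.obj.map h (T.param.hom.app c p) :=
  NatTrans.naturality_apply T.param.hom h p

/-- The point `p + d` of a chart, for `d ∈ D_1(n)`. -/
noncomputable def shift {c : Cᵒᵖ} (p : T.dom.obj.obj c) (d : (D R 1 n).obj c) :
    T.dom.obj.obj c :=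
  (T.formallyOpen p (T.coord p + d.1) (by rw [add_sub_cancel_left]; exact d.2)).choose

theorem coord_shift {c : Cᵒᵖ} (p : T.dom.obj.obj c) (d : (D R 1 n).obj c) :
    T.coord (T.shift p d) = T.coord p + d.1 :=
  (T.formallyOpen p (T.coord p + d.1) (by rw [add_sub_cancel_left]; exact d.2)).choose_spec

theorem shift_eq {c : Cᵒᵖ} {p q : T.dom.obj.obj c} {d : (D R 1 n).obj c}
    (h : T.coord q = T.coord p + d.1) : T.shift p d = q :=
  T.coord_injective c (by rw [coord_shift, h])

theorem shift_zero {c : Cᵒᵖ} (p : T.dom.obj.obj c) : T.shift p (D.zero R 1 n c) = p :=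
  T.shift_eq (by simp [D.zero]; rfl)

theorem map_shift {c e : Cᵒᵖ} (h : c ⟶ e) (p : T.dom.obj.obj c) (d : (D R 1 n).obj c) :
    T.dom.obj.map h (T.shift p d) = T.shift (T.dom.obj.map h p) ((D R 1 n).map h d) := by
  refine (T.shift_eq ?_).symm
  funext i
  rw [T.coord_map, coord_shift, Pi.add_apply, Pi.add_apply, R.map_add, T.coord_map, D.map_val]

theorem shift_comm {c : Cᵒᵖ} (p : T.dom.obj.obj c) (d e : (D R 1 n).obj c) :
    T.shift (T.shift p d) e = T.shift (T.shift p e) d :=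
  T.shift_eq (by rw [coord_shift, coord_shift, coord_shift, add_right_comm])

/-- Neighbours in one chart are neighbours in any other chart that contains one of them. -/
theorem exists_lift (hR : R.IsLine) (T' : Chart R n M) {c : Cᵒᵖ} (p : T.dom.obj.obj c)
    (p' q' : T'.dom.obj.obj c) (hp : T.param.hom.app c p = T'.param.hom.app c p')
    (hq : MemD R 1 n (T'.coord q' - T'.coord p')) :
    ∃ q : T.dom.obj.obj c, T.param.hom.app c q = T'.param.hom.app c q' ∧
      MemD R 1 n (T.coord q - T.coord p) := by
  -- The infinitesimal disc around `p'` in the chart `T'`, viewed in `M`; étaleness of `T` lifts it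
  -- to a disc around `p`.
  let g : InternalMap (D R 1 n) M.obj c :=
    { app := fun {e} h d => T'.param.hom.app e (T'.shift (T'.dom.obj.map h p') d)
      naturality := fun h g x => by
        rw [← param_map, map_shift]; simp }
  obtain ⟨l, ⟨hl0, hl⟩, -⟩ := T.param_etale n c p g (by
    change T'.param.hom.app c (T'.shift (T'.dom.obj.map (𝟙 c) p') _) = _
    rw [shift_zero, hp]; simp)
  let d : (D R 1 n).obj c := ⟨_, hq⟩
  refine ⟨l.app (𝟙 c) d, ?_, ?_⟩
  · rw [hl]
    change T'.param.hom.app c (T'.shift (T'.dom.obj.map (𝟙 c) p') d) = _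
    rw [T'.shift_eq (q := q')]
    simp [d]
  · let f (k : Fin n) : InternalMap (D R 1 n) R.carrier.obj c :=
      { app := fun {e} h d => T.coord (l.app h d) k
        naturality := fun h g x => by rw [l.naturality, T.coord_map] }
    choose b hb using fun k => hR.linear (f k)
    -- On `D_1(n)` the coordinates of the lifted disc are affine in `d`. The coordinate differences
    -- are thus linear in `d`, and their products vanish with the `d_i d_j`.
    have key : ∀ k, (T.coord (l.app (𝟙 c) d) - T.coord p) k = ∑ j, d.1 j * b k j := by
      intro k
      have := hb k d
      simp only [f, hl0] at this
      rw [Pi.sub_apply, this, add_sub_cancel_left]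
    rw [memD_one_iff]
    intro k k'
    rw [key, key, Finset.sum_mul_sum]
    refine Finset.sum_eq_zero fun i _ => Finset.sum_eq_zero fun j _ => ?_
    rw [mul_mul_mul_comm, memD_one_iff.1 d.2, zero_mul]

end Chart

namespace Manifold

variable {R : RingObject.{v, u, w} J} {n : ℕ} {M : Manifold.{v, u, w, t} R n}

theorem neighbour_of_memD {c : Cᵒᵖ} (i : M.index) (p q : (M.chart i).dom.obj.obj c)
    (h : MemD R 1 n ((M.chart i).coord q - (M.chart i).coord p)) :
    M.Neighbour ((M.chart i).param.hom.app c p) ((M.chart i).param.hom.app c q) := by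
  refine ⟨⊤, J.top_mem _, fun {d} f _ => ⟨i, (M.chart i).dom.obj.map f p,
    (M.chart i).dom.obj.map f q, Chart.param_map _ _ _, Chart.param_map _ _ _, ?_⟩⟩
  have : (M.chart i).coord ((M.chart i).dom.obj.map f q) -
      (M.chart i).coord ((M.chart i).dom.obj.map f p) =
      fun k => R.carrier.obj.map f (((M.chart i).coord q - (M.chart i).coord p) k) := by
    funext k
    rw [Pi.sub_apply, Chart.coord_map, Chart.coord_map, Pi.sub_apply, R.map_sub]
  rw [this]
  exact h.map f

/-- The neighbours of a point of a chart lie in this chart. -/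
theorem Neighbour.exists_lift (hR : R.IsLine) {c : Cᵒᵖ} (T : Chart R n M.carrier)
    (p : T.dom.obj.obj c) {y : M.carrier.obj.obj c} (h : M.Neighbour (T.param.hom.app c p) y) :
    ∃ q : T.dom.obj.obj c, T.param.hom.app c q = y ∧ MemD R 1 n (T.coord q - T.coord p) := by
  obtain ⟨S, hS, H⟩ := h
  obtain ⟨q, hq⟩ := exists_of_locally_existsUnique T.dom hS
    (fun {d} f q => T.param.hom.app d q = M.carrier.obj.map f y ∧
      MemD R 1 n (T.coord q - T.coord (T.dom.obj.map f p)))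
    (fun {d e} f g a ha => by
      refine ⟨by rw [T.param_map, ha.1]; simp, ?_⟩
      have : T.coord (T.dom.obj.map g a) - T.coord (T.dom.obj.map (f ≫ g) p) =
          fun k => R.carrier.obj.map g ((T.coord a - T.coord (T.dom.obj.map f p)) k) := by
        funext k
        rw [Functor.map_comp, types_comp_apply, Pi.sub_apply, Chart.coord_map, Chart.coord_map,
          Pi.sub_apply, R.map_sub]
      rw [this]
      exact ha.2.map g)
    -- Lifts are unique since the chart is monic, so those found on the covering glue.
    (fun {d} f a b ha hb => T.param_injective d (ha.1.trans hb.1.symm))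
    (fun {d} f hf => by
      obtain ⟨j, p', q', hp', hq', hd⟩ := H f hf
      obtain ⟨q, hq, hqd⟩ := T.exists_lift hR (M.chart j) (T.dom.obj.map f p) p' q'
        (by rw [hp', T.param_map]) hd
      exact ⟨q, hq.trans hq', hqd⟩)
  refine ⟨q, sheaf_ext _ hS fun f hf => ?_, fun s => sheaf_ext _ hS fun f hf => ?_⟩
  · rw [← T.param_map, (hq f hf).1]
  · rw [R.map_prod, R.map_zero, ← (hq f hf).2 s]
    refine Finset.prod_congr rfl fun k _ => ?_
    rw [Pi.sub_apply, Pi.sub_apply, R.map_sub, T.coord_map, T.coord_map]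

end Manifold

end SDG

/-! ### Cancelling infinitesimals, and the module of `W`-valued functions -/

namespace SDG

variable {C : Type u} [Category.{v} C] {J : GrothendieckTopology C}

theorem ModuleObject.IsKL.cancel_four {R : RingObject.{v, u, w} J} {V : ModuleObject R}
    (hV : V.IsKL) {c : Cᵒᵖ} (a : V.carrier.obj.obj c)
    (H : ∀ {e : Cᵒᵖ} (h : c ⟶ e) (s₁ s₂ s₃ s₄ : R.carrier.obj.obj e), s₁ * s₁ = 0 →
      s₂ * s₂ = 0 → s₃ * s₃ = 0 → s₄ * s₄ = 0 →
      (s₁ * s₂ * s₃ * s₄) • V.carrier.obj.map h a = 0) : a = 0 := by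
  have sq {c d : Cᵒᵖ} (h : c ⟶ d) {s : R.carrier.obj.obj c} (hs : s * s = 0) :
      R.carrier.obj.map h s * R.carrier.obj.map h s = 0 := by
    rw [← R.map_mul, hs, R.map_zero]
  -- Cancel one factor at a time; each new one lives at a later stage, to which the earlier ones are
  -- restricted.
  refine hV.cancel a fun h₁ s₁ hs₁ => hV.cancel _ fun h₂ s₂ hs₂ =>
    hV.cancel _ fun h₃ s₃ hs₃ => hV.cancel _ fun h₄ s₄ hs₄ => ?_
  have := H (h₁ ≫ h₂ ≫ h₃ ≫ h₄) _ _ _ s₄ (sq h₄ (sq h₃ (sq h₂ hs₁))) (sq h₄ (sq h₃ hs₂))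
    (sq h₄ hs₃) hs₄
  simp only [V.map_smul, smul_smul, R.map_mul]
  rw [← this]
  simp only [Functor.map_comp, types_comp_apply]
  congr 1
  ring

/-- Two elements `u`, `v` of `A ^ n` with `u k * v l + v k * u l = 0`. -/
theorem antisymm_pair {A ι : Type*} [CommRing A] [DecidableEq ι] {i j : ι} (hij : i ≠ j)
    {s t : A} (hs : s * s = 0) (ht : t * t = 0) (k l : ι) :
    (Pi.single i s + Pi.single j t : ι → A) k * (Pi.single i (-s) + Pi.single j t : ι → A) l +
      (Pi.single i (-s) + Pi.single j t : ι → A) k *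
        (Pi.single i s + Pi.single j t : ι → A) l = 0 := by
  have hji := hij.symm
  simp only [Pi.add_apply, Pi.single_apply]
  split_ifs <;> simp_all [mul_comm]

namespace InternalMap

variable {R : RingObject.{v, u, w} J} {W : AlgebraObject R} {X Y : Cᵒᵖ ⥤ Type w} {c : Cᵒᵖ}

@[ext]
theorem ext {f g : InternalMap X Y c}
    (h : ∀ {d : Cᵒᵖ} (k : c ⟶ d) (x : X.obj d), f.app k x = g.app k x) : f = g := by
  cases f
  cases g
  congr
  funext d k x
  exact h k x

instance : Zero (InternalMap X W.carrier.obj c) :=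
  ⟨⟨fun _ _ => 0, fun _ g _ => (W.toModuleObject.map_zero g).symm⟩⟩

instance : One (InternalMap X W.carrier.obj c) :=
  ⟨⟨fun _ _ => 1, fun _ g _ => (W.map_one g).symm⟩⟩

instance : Add (InternalMap X W.carrier.obj c) :=
  ⟨fun f g => ⟨fun h x => f.app h x + g.app h x, fun h k x => by
    rw [f.naturality, g.naturality, W.map_add]⟩⟩

instance : Neg (InternalMap X W.carrier.obj c) :=
  ⟨fun f => ⟨fun h x => -f.app h x, fun h k x => by
    rw [f.naturality]; exact (W.toModuleObject.map_neg k _).symm⟩⟩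

instance : SMul (R.carrier.obj.obj c) (InternalMap X W.carrier.obj c) :=
  ⟨fun r f => ⟨fun h x => R.carrier.obj.map h r • f.app h x, fun h k x => by
    rw [f.naturality, W.map_smul, Functor.map_comp, types_comp_apply]⟩⟩

variable {d : Cᵒᵖ} (h : c ⟶ d) (x : X.obj d) (f g : InternalMap X W.carrier.obj c)

theorem one_app : (1 : InternalMap X W.carrier.obj c).app h x = 1 := rfl

theorem add_app : (f + g).app h x = f.app h x + g.app h x := rfl

theorem smul_app (r : R.carrier.obj.obj c) :
    (r • f).app h x = R.carrier.obj.map h r • f.app h x := rfl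

instance : AddCommGroup (InternalMap X W.carrier.obj c) where
  add_assoc f g k := ext fun h x => add_assoc _ _ _
  zero_add f := ext fun h x => zero_add _
  add_zero f := ext fun h x => add_zero _
  add_comm f g := ext fun h x => add_comm _ _
  neg_add_cancel f := ext fun h x => neg_add_cancel _
  nsmul := nsmulRec
  zsmul := zsmulRec

instance : Module (R.carrier.obj.obj c) (InternalMap X W.carrier.obj c) where
  one_smul f := ext fun h x => by rw [smul_app, R.map_one, one_smul]
  mul_smul r s f := ext fun h x => by rw [smul_app, R.map_mul, mul_smul]; rfl
  smul_zero r := ext fun h x => smul_zero _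
  smul_add r f g := ext fun h x => smul_add _ _ _
  add_smul r s f := ext fun h x => by rw [smul_app, R.map_add, add_smul]; rfl
  zero_smul f := ext fun h x => by rw [smul_app, R.map_zero, zero_smul]; rfl

theorem sum_app {ι : Type} (s : Finset ι) (F : ι → InternalMap X W.carrier.obj c) :
    (∑ i ∈ s, F i).app h x = ∑ i ∈ s, (F i).app h x := by
  classical
  induction s using Finset.induction_on with
  | empty => rfl
  | insert a s ha ih => rw [Finset.sum_insert ha, Finset.sum_insert ha, add_app, ih]

end InternalMap

/-! ### Flat transport and covariant derivatives -/

/-- The coordinates of an element of `D_k(n)`. -/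
def D.coords {R : RingObject.{v, u, w} J} {k n : ℕ} {c : Cᵒᵖ} (d : (D R k n).obj c) :
    Fin n → R.carrier.obj.obj c := d.1

/-- A flat parallel transport along the neighbour relation of a chart, with values in an
algebra. -/
structure FlatTransport {R : RingObject.{v, u, w} J} {n : ℕ} {M : Sheaf J (Type w)}
    (T : Chart R n M) (W : AlgebraObject R) where
  app : ∀ {c : Cᵒᵖ}, T.dom.obj.obj c → (D R 1 n).obj c → W.carrier.obj.obj c
  map_app : ∀ {c e : Cᵒᵖ} (h : c ⟶ e) (p : T.dom.obj.obj c) (d : (D R 1 n).obj c),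
    W.carrier.obj.map h (app p d) = app (T.dom.obj.map h p) ((D R 1 n).map h d)
  app_zero : ∀ {c : Cᵒᵖ} (p : T.dom.obj.obj c), app p (D.zero R 1 n c) = 1
  flat : ∀ {c : Cᵒᵖ} (p : T.dom.obj.obj c) (d e f : (D R 1 n).obj c), f.1 = e.1 - d.1 →
    app p d * app (T.shift p d) f = app p e

namespace FlatTransport

variable {R : RingObject.{v, u, w} J} {n : ℕ} {M : Sheaf J (Type w)}
  {T : Chart R n M} {W : AlgebraObject R} (ω : FlatTransport T W)

/-- The map `d ↦ ω(p, p + d) * g(p + d)`. -/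
noncomputable def slice {c e : Cᵒᵖ} (g : InternalMap T.dom.obj W.carrier.obj c) (h : c ⟶ e)
    (p : T.dom.obj.obj e) : InternalMap (D R 1 n) W.carrier.obj e where
  app k d := ω.app (T.dom.obj.map k p) d * g.app (h ≫ k) (T.shift (T.dom.obj.map k p) d)
  naturality k l d := by
    rw [W.map_mul, ω.map_app, ← g.naturality, T.map_shift]
    simp only [Functor.map_comp, types_comp_apply, Category.assoc]

theorem exists_slice (hW : W.toModuleObject.IsKL) {c e : Cᵒᵖ} (g : InternalMap T.dom.obj W.carrier.obj c) (h : c ⟶ e)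
    (p : T.dom.obj.obj e) :
    ∃ b : Fin n → W.carrier.obj.obj e, ∀ {e' : Cᵒᵖ} (k : e ⟶ e') (d : (D R 1 n).obj e'),
      (ω.slice g h p).app k d = W.carrier.obj.map k (g.app h p) +
        ∑ j, d.1 j • W.carrier.obj.map k (b j) := by
  obtain ⟨b, hb⟩ := ModuleObject.IsKL.linear hW (ω.slice g h p)
  refine ⟨b, fun k d => (hb k d).trans ?_⟩
  have : (ω.slice g h p).app (𝟙 e) (D.zero R 1 n e) = g.app h p := by
    simp [slice, ω.app_zero, T.shift_zero]
  rw [this]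
  rfl

/-- The covariant partial derivatives of `g`. -/
noncomputable def coeff (hW : W.toModuleObject.IsKL) {c e : Cᵒᵖ}
    (g : InternalMap T.dom.obj W.carrier.obj c) (h : c ⟶ e) (p : T.dom.obj.obj e) :
    Fin n → W.carrier.obj.obj e :=
  (ω.exists_slice hW g h p).choose

theorem slice_app (hW : W.toModuleObject.IsKL) {c e e' : Cᵒᵖ}
    (g : InternalMap T.dom.obj W.carrier.obj c)
    (h : c ⟶ e) (p : T.dom.obj.obj e) (k : e ⟶ e') (d : (D R 1 n).obj e') :
    (ω.slice g h p).app k d = W.carrier.obj.map k (g.app h p) +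
      ∑ j, d.1 j • W.carrier.obj.map k (ω.coeff hW g h p j) :=
  (ω.exists_slice hW g h p).choose_spec k d

/-- Uniqueness of the linear coefficients; this makes the chosen `coeff` natural in the stage and
linear in `g`. -/
theorem coeff_eq (hW : W.toModuleObject.IsKL) {c e : Cᵒᵖ}
    (g : InternalMap T.dom.obj W.carrier.obj c)
    (h : c ⟶ e) (p : T.dom.obj.obj e) (b : Fin n → W.carrier.obj.obj e)
    (H : ∀ {e' : Cᵒᵖ} (k : e ⟶ e') (d : (D R 1 n).obj e'),
      (ω.slice g h p).app k d = W.carrier.obj.map k (g.app h p) +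
        ∑ j, d.1 j • W.carrier.obj.map k (b j)) : ω.coeff hW g h p = b :=
  ModuleObject.IsKL.linear_unique hW _ _ _ _ fun k d =>
    (ω.slice_app hW g h p k d).symm.trans (H k d)

/-- Covariant partial differentiation. -/
noncomputable def deriv (hW : W.toModuleObject.IsKL) (c : Cᵒᵖ) (j : Fin n) :
    Module.End (R.carrier.obj.obj c) (InternalMap T.dom.obj W.carrier.obj c) where
  toFun g :=
    { app := fun h p => ω.coeff hW g h p j
      naturality := fun {d e} h l p => by
        refine congrFun (ω.coeff_eq hW g (h ≫ l) (T.dom.obj.map l p)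
          (fun j => W.carrier.obj.map l (ω.coeff hW g h p j)) fun k d => ?_) j
        have := ω.slice_app hW g h p (l ≫ k) d
        simp only [slice, Functor.map_comp, types_comp_apply, Category.assoc,
          g.naturality] at this ⊢
        exact this }
  map_add' f g := InternalMap.ext fun h p => by
    refine congrFun (ω.coeff_eq hW (f + g) h p
      (fun j => ω.coeff hW f h p j + ω.coeff hW g h p j) fun k d => ?_) j
    have hf := ω.slice_app hW f h p k d
    have hg := ω.slice_app hW g h p k d
    simp only [slice, InternalMap.add_app, W.map_add, mul_add, smul_add,
      Finset.sum_add_distrib] at hf hg ⊢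
    rw [hf, hg]
    abel
  map_smul' r g := InternalMap.ext fun h p => by
    refine congrFun (ω.coeff_eq hW (r • g) h p
      (fun j => R.carrier.obj.map h r • ω.coeff hW g h p j) fun k d => ?_) j
    have hg := ω.slice_app hW g h p k d
    simp only [slice, InternalMap.smul_app, W.map_smul, Functor.map_comp, types_comp_apply,
      mul_smul_comm] at hg ⊢
    rw [hg, smul_add, Finset.smul_sum]
    congr 1
    exact Finset.sum_congr rfl fun j _ => smul_comm _ _ _

theorem deriv_app (hW : W.toModuleObject.IsKL) {c e : Cᵒᵖ} (j : Fin n)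
    (g : InternalMap T.dom.obj W.carrier.obj c) (h : c ⟶ e) (p : T.dom.obj.obj e) :
    (ω.deriv hW c j g).app h p = ω.coeff hW g h p j := rfl

theorem app_mul_app (hW : W.toModuleObject.IsKL) {c e : Cᵒᵖ}
    (g : InternalMap T.dom.obj W.carrier.obj c)
    (h : c ⟶ e) (p : T.dom.obj.obj e) (d : (D R 1 n).obj e) :
    ω.app p d * g.app h (T.shift p d) =
      g.app h p + ∑ j, d.1 j • (ω.deriv hW c j g).app h p := by
  have := ω.slice_app hW g h p (𝟙 e) d
  simpa [slice, deriv_app] using this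

/-- Parallel translation of a function along `d`, as a polynomial in the derivatives. -/
noncomputable def translate (hW : W.toModuleObject.IsKL) {c : Cᵒᵖ} (d : (D R 1 n).obj c) :
    Module.End (R.carrier.obj.obj c) (InternalMap T.dom.obj W.carrier.obj c) :=
  1 + ∑ j, d.1 j • ω.deriv hW c j

theorem translate_app (hW : W.toModuleObject.IsKL) {c e : Cᵒᵖ} (d : (D R 1 n).obj c)
    (g : InternalMap T.dom.obj W.carrier.obj c) (h : c ⟶ e) (p : T.dom.obj.obj e) :
    (ω.translate hW d g).app h p =
      ω.app p ((D R 1 n).map h d) * g.app h (T.shift p ((D R 1 n).map h d)) := by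
  rw [app_mul_app (hW := hW)]
  simp only [translate, LinearMap.add_apply, Module.End.one_apply, InternalMap.add_app,
    LinearMap.sum_apply, LinearMap.smul_apply, InternalMap.sum_app, InternalMap.smul_app,
    D.map_val]

/-- Second-order expansion: apply `app_mul_app` to `1` at the shifted point, then to each `∂_j 1` at
`p`. The displacements `d` and `f` are independent here. -/
theorem app_mul_app_shift (hW : W.toModuleObject.IsKL) {c e : Cᵒᵖ} (h : c ⟶ e)
    (p : T.dom.obj.obj e) (d f : (D R 1 n).obj e) :
    ω.app p d * ω.app (T.shift p d) f =
      1 + ∑ i, d.1 i • (ω.deriv hW c i 1).app h p + ∑ j, f.1 j • (ω.deriv hW c j 1).app h p +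
        ∑ j, ∑ i, (f.1 j * d.1 i) • (ω.deriv hW c i (ω.deriv hW c j 1)).app h p := by
  have h1 := fun q d => ω.app_mul_app hW (1 : InternalMap T.dom.obj W.carrier.obj c) h q d
  simp only [InternalMap.one_app, mul_one] at h1
  have h2 : ∀ j, ω.app p d * (f.1 j • (ω.deriv hW c j 1).app h (T.shift p d)) =
      f.1 j • (ω.deriv hW c j 1).app h p +
        ∑ i, (f.1 j * d.1 i) • (ω.deriv hW c i (ω.deriv hW c j 1)).app h p := fun j => by
    rw [mul_smul_comm, app_mul_app (hW := hW), smul_add, Finset.smul_sum]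
    simp only [smul_smul]
  rw [h1 (T.shift p d) f, mul_add, mul_one, Finset.mul_sum, Finset.sum_congr rfl fun j _ => h2 j,
    Finset.sum_add_distrib, h1 p d]
  exact (add_assoc _ _ _).symm

/-- The hypothesis on `d` and `f` says that `f - d` is again in `D_1(n)`. Flatness on the triangle
`p, p + d, p + f` then applies, and its terms of order at most one cancel. -/
theorem sum_smul_deriv_deriv (hW : W.toModuleObject.IsKL) {c e : Cᵒᵖ} (h : c ⟶ e)
    (p : T.dom.obj.obj e) (d f : (D R 1 n).obj e)
    (hdf : ∀ k l, f.1 k * d.1 l + d.1 k * f.1 l = 0) :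
    ∑ j, ∑ i, (f.1 j * d.1 i) • (ω.deriv hW c i (ω.deriv hW c j 1)).app h p = 0 := by
  have hd := memD_one_iff.1 d.2
  have hf := memD_one_iff.1 f.2
  let g : (D R 1 n).obj e := ⟨f.1 - d.1, memD_one_iff.2 fun k l => by
    rw [Pi.sub_apply, Pi.sub_apply]
    linear_combination hf k l - hdf k l + hd k l⟩
  have hflat := ω.flat p d f g rfl
  rw [app_mul_app_shift (hW := hW) (h := h)] at hflat
  have h1 := ω.app_mul_app hW (1 : InternalMap T.dom.obj W.carrier.obj c) h p f
  simp only [InternalMap.one_app, mul_one] at h1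
  -- The second leg is `f - d`, but `d_j d_i = 0` removes the `d` part from the quadratic term.
  have h2 : ∀ i j, g.1 j * d.1 i = f.1 j * d.1 i := fun i j => by
    simp only [g, Pi.sub_apply, sub_mul, hd, sub_zero]
  have h3 : ∀ j, g.1 j = f.1 j - d.1 j := fun j => rfl
  rw [h1] at hflat
  simp only [h2] at hflat
  simp only [h3, sub_smul, Finset.sum_sub_distrib] at hflat
  rw [add_assoc 1, add_sub_cancel] at hflat
  exact left_eq_add.1 hflat.symm

/-- Vanishing curvature: test `sum_smul_deriv_deriv` on a pair `d, f` whose symmetric products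
vanish while the antisymmetric `(i, j)` part survives, then cancel the infinitesimal factors. -/
theorem deriv_deriv_comm (hW : W.toModuleObject.IsKL) (c : Cᵒᵖ) (i j : Fin n)
    (p : T.dom.obj.obj c) :
    (ω.deriv hW c i (ω.deriv hW c j 1)).app (𝟙 c) p =
      (ω.deriv hW c j (ω.deriv hW c i 1)).app (𝟙 c) p := by
  by_cases hij : i = j
  · rw [hij]
  rw [← sub_eq_zero]
  refine ModuleObject.IsKL.cancel_four hW _ fun {e} h s₁ s₂ s₃ s₄ h₁ h₂ h₃ h₄ => ?_
  -- The symmetrized products of `u` and `v` vanish, but neither need lie in `D_1(n)`, as `s₂ * s₃`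
  -- may be nonzero. The scalars `s₁` and `s₄` of square zero repair this.
  let u : Fin n → R.carrier.obj.obj e := Pi.single i s₂ + Pi.single j s₃
  let v : Fin n → R.carrier.obj.obj e := Pi.single i (-s₂) + Pi.single j s₃
  have huv : ∀ k l, u k * v l + v k * u l = 0 := antisymm_pair hij h₂ h₃
  let d : (D R 1 n).obj e := ⟨fun k => s₁ * u k, memD_one_iff.2 fun k l => by
    linear_combination (u k * u l) * h₁⟩
  let f : (D R 1 n).obj e := ⟨fun k => s₄ * v k, memD_one_iff.2 fun k l => by
    linear_combination (v k * v l) * h₄⟩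
  have key := ω.sum_smul_deriv_deriv hW h (T.dom.obj.map h p) d f fun k l => by
    simp only [d, f]
    linear_combination (s₁ * s₄) * huv k l
  -- The diagonal terms contain `s₂²` or `s₃²`; only the two mixed terms remain, with opposite
  -- signs.
  have h22 : s₄ * s₂ * (s₁ * s₂) = 0 := by linear_combination s₄ * s₁ * h₂
  have h33 : s₄ * s₃ * (s₁ * s₃) = 0 := by linear_combination s₄ * s₁ * h₃
  have hnat : ∀ g : InternalMap T.dom.obj W.carrier.obj c,
      W.carrier.obj.map h (g.app (𝟙 c) p) = g.app h (T.dom.obj.map h p) := fun g => by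
    rw [← g.naturality, Category.id_comp]
  simp only [d, f, u, v, mul_add, add_mul, add_smul, Finset.sum_add_distrib, Pi.single_apply,
    Pi.add_apply, mul_ite, ite_mul, mul_zero, zero_mul, ite_smul, zero_smul,
    Finset.sum_ite_eq', Finset.mem_univ, if_true, mul_neg, neg_mul, neg_smul, h22, h33,
    neg_zero, zero_add, add_zero] at key
  have hsub : ∀ a b, W.carrier.obj.map h (a - b) =
      W.carrier.obj.map h a - W.carrier.obj.map h b := W.toModuleObject.map_sub h
  refine Eq.trans ?_ key
  change (s₁ * s₂ * s₃ * s₄) • W.carrier.obj.map h (_ - _) = _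
  rw [hsub, hnat, hnat, smul_sub, sub_eq_add_neg]
  have e₁ : s₄ * s₃ * (s₁ * s₂) = s₁ * s₂ * s₃ * s₄ := by ring
  have e₂ : s₄ * s₂ * (s₁ * s₃) = s₁ * s₂ * s₃ * s₄ := by ring
  rw [e₁, e₂]

/-- In the second-order expansion, exchanging `d` and `f` only exchanges the order of the two
derivatives of `1`. -/
theorem app_mul_app_shift_comm (hW : W.toModuleObject.IsKL) {c : Cᵒᵖ}
    (p : T.dom.obj.obj c) (d f : (D R 1 n).obj c) :
    ω.app p d * ω.app (T.shift p d) f = ω.app p f * ω.app (T.shift p f) d := by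
  rw [ω.app_mul_app_shift hW (𝟙 c), ω.app_mul_app_shift hW (𝟙 c), Finset.sum_comm]
  simp only [ω.deriv_deriv_comm hW c, mul_comm]
  abel

theorem translate_commute (hW : W.toModuleObject.IsKL) {c : Cᵒᵖ} (d f : (D R 1 n).obj c) :
    Commute (ω.translate hW d) (ω.translate hW f) := by
  refine LinearMap.ext fun g => InternalMap.ext fun h p => ?_
  simp only [Module.End.mul_apply, translate_app]
  -- Both composites evaluate `g` at `p + d + f`, so only the transport factors in front of it have
  -- to be compared.
  rw [← mul_assoc, ← mul_assoc, app_mul_app_shift_comm (hW := hW), T.shift_comm]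

/-- Parallel translation along a list of displacements depends only on their sum. -/
theorem prod_translate_eq (hR : R.IsLine) (hW : W.toModuleObject.IsKL) {c : Cᵒᵖ}
    (L L' : List ((D R 1 n).obj c))
    (h : (L.map D.coords).sum = (L'.map D.coords).sum) :
    (L.map (ω.translate hW)).prod = (L'.map (ω.translate hW)).prod := by
  obtain ⟨_⟩ := nonempty_algebra_rat (hR.isUnit_natCast c)
  -- The rationals act on operators through `R` at stage `c`; the exponential series needs these
  -- scalars.
  let _ : Module ℚ (Module.End (R.carrier.obj.obj c) (InternalMap T.dom.obj W.carrier.obj c)) :=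
    Module.compHom _ (algebraMap ℚ (R.carrier.obj.obj c))
  let t (d : (D R 1 n).obj c) := ∑ j, d.1 j • ω.deriv hW c j
  have ht : ∀ d, ω.translate hW d = 1 + t d := fun d => rfl
  have hsq : ∀ d, t d * t d = 0 := fun d => by
    simp only [t, Finset.sum_mul_sum]
    refine Finset.sum_eq_zero fun i _ => Finset.sum_eq_zero fun j _ => ?_
    rw [smul_mul_smul_comm, memD_one_iff.1 d.2, zero_smul]
  have hcomm : ∀ d e, Commute (t d) (t e) := fun d e => by
    have := ω.translate_commute hW d e
    rw [ht, ht] at this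
    simpa using (this.sub_left (Commute.one_left _)).sub_right (Commute.one_right _)
  have hsum : ∀ L : List ((D R 1 n).obj c),
      (L.map t).sum = ∑ j, (L.map D.coords).sum j • ω.deriv hW c j := fun L => by
    induction L with
    | nil => simp
    | cons a L ih =>
      simp only [List.map_cons, List.sum_cons, Pi.add_apply, add_smul, Finset.sum_add_distrib,
        ih, t, D.coords]
  change (L.map fun d => 1 + t d).prod = (L'.map fun d => 1 + t d).prod
  rw [(prod_one_add_eq_exp t hsq hcomm L).2, (prod_one_add_eq_exp t hsq hcomm L').2, hsum, hsum, h]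

end FlatTransport

end SDG

/-! ### Path integrals as iterated translations -/

namespace SDG

variable {C : Type u} [Category.{v} C] {J : GrothendieckTopology C}

/-- Restriction along a change of stage, as a homomorphism of groups. -/
def GroupObject.res (G : GroupObject.{v, u, w} J) {c d : Cᵒᵖ} (h : c ⟶ d) :
    G.carrier.obj.obj c →* G.carrier.obj.obj d :=
  MonoidHom.mk' (G.carrier.obj.map h) (G.map_mul h)

namespace Manifold

variable {R : RingObject.{v, u, w} J} {n : ℕ} {M : Manifold.{v, u, w, t} R n}
  {G : GroupObject.{v, u, w} J}

namespace OneForm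

variable (ω : M.OneForm G)

theorem val_congr {c : Cᵒᵖ} {x x' y y' : M.carrier.obj.obj c} (hx : x = x') (hy : y = y')
    (h : M.Neighbour x y) (h' : M.Neighbour x' y') : ω.val x y h = ω.val x' y' h' := by
  subst hx hy
  rfl

theorem map_val {c d : Cᵒᵖ} (f : c ⟶ d) {x y : M.carrier.obj.obj c} (h : M.Neighbour x y) :
    G.carrier.obj.map f (ω.val x y h) =
      ω.val (M.carrier.obj.map f x) (M.carrier.obj.map f y) (h.map f) :=
  (NatTrans.naturality_apply ω.toHom f ⟨(x, y), h⟩).symm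

/-- A closed form with values in a matrix group gives a flat transport in every chart. -/
noncomputable def toFlatTransport (hω : ω.IsClosed) (i : M.index) (W : AlgebraObject R)
    (j : ∀ c, G.carrier.obj.obj c →* W.carrier.obj.obj c)
    (hj : ∀ {c d : Cᵒᵖ} (h : c ⟶ d) (g : G.carrier.obj.obj c),
      j d (G.carrier.obj.map h g) = W.carrier.obj.map h (j c g)) :
    FlatTransport (M.chart i) W where
  app {c} p d := j c (ω.val ((M.chart i).param.hom.app c p)
    ((M.chart i).param.hom.app c ((M.chart i).shift p d)) (neighbour_of_memD i p _ (by
      rw [Chart.coord_shift, add_sub_cancel_left]; exact d.2)))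
  map_app h p d := by
    rw [← hj, map_val]
    congr 1
    exact ω.val_congr (Chart.param_map _ _ _).symm
      (by rw [← Chart.map_shift, Chart.param_map]) _ _
  app_zero {c} p := by
    rw [ω.val_congr rfl (congrArg _ ((M.chart i).shift_zero p)) _ (Neighbour.refl _)]
    exact (congrArg (j c) (ω.app_self _)).trans (map_one _)
  flat {c} p d e f h := by
    have hs : (M.chart i).shift ((M.chart i).shift p d) f = (M.chart i).shift p e := by
      refine Chart.shift_eq _ ?_
      rw [Chart.coord_shift, Chart.coord_shift, h]
      abel
    -- The third side of the triangle has displacement `e ∈ D_1(n)`, so its ends are neighbours and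
    -- closedness applies.
    rw [← map_mul, hω _ _ _ _ _ (neighbour_of_memD i p _ (by
      rw [hs, Chart.coord_shift, add_sub_cancel_left]; exact e.2))]
    congr 1
    exact ω.val_congr rfl (by rw [hs]) _ _

end OneForm

namespace Path

/-- Restriction of a path along a change of stage. -/
def map {l : ℕ} {c d : Cᵒᵖ} (f : c ⟶ d) (x : M.Path l c) : M.Path l d where
  point i := M.carrier.obj.map f (x.point i)
  neighbour i := (x.neighbour i).map f

/-- A path without its first point. -/
def tail {l : ℕ} {c : Cᵒᵖ} (x : M.Path (l + 1) c) : M.Path l c where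
  point i := x.point i.succ
  neighbour i := x.neighbour i.succ

end Path

namespace OneForm

variable (ω : M.OneForm G)

theorem integral_map {l : ℕ} {c d : Cᵒᵖ} (f : c ⟶ d) (x : M.Path l c) :
    ω.integral (x.map f) = G.carrier.obj.map f (ω.integral x) := by
  change _ = G.res f (ω.integral x)
  rw [integral, integral, map_list_prod, List.map_ofFn]
  congr 2
  funext i
  exact (ω.map_val f _).symm

theorem integral_succ {l : ℕ} {c : Cᵒᵖ} (x : M.Path (l + 1) c) :
    ω.integral x = ω.val (x.point 0) (x.point 1) (x.neighbour 0) * ω.integral x.tail := by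
  rw [integral, List.ofFn_succ, List.prod_cons]
  rfl

/-- The integral along a path that starts in a chart is obtained by translating the constant
function `1`. -/
theorem exists_integral_eq (hR : R.IsLine) (hω : ω.IsClosed) (i : M.index) {W : AlgebraObject R}
    (hW : W.toModuleObject.IsKL) (j : ∀ c, G.carrier.obj.obj c →* W.carrier.obj.obj c)
    (hj : ∀ {c d : Cᵒᵖ} (h : c ⟶ d) (g : G.carrier.obj.obj c),
      j d (G.carrier.obj.map h g) = W.carrier.obj.map h (j c g))
    {c : Cᵒᵖ} {l : ℕ} (x : M.Path l c) (p : (M.chart i).dom.obj.obj c)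
    (hp : (M.chart i).param.hom.app c p = x.domain) :
    ∃ (L : List ((D R 1 n).obj c)) (q : (M.chart i).dom.obj.obj c),
      (M.chart i).param.hom.app c q = x.codomain ∧
      (M.chart i).coord q = (M.chart i).coord p + (L.map D.coords).sum ∧
      j c (ω.integral x) =
        ((L.map ((ω.toFlatTransport hω i W j hj).translate hW)).prod 1).app (𝟙 c) p := by
  induction l generalizing p with
  | zero => exact ⟨[], p, hp, by simp, by simp [integral, InternalMap.one_app]⟩
  | succ l ih =>
    have hn : M.Neighbour ((M.chart i).param.hom.app c p) (x.point 1) := by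
      rw [hp]
      exact x.neighbour 0
    -- The next point of the path stays in the same chart, so one chart serves for the whole path.
    obtain ⟨p', hp', hd⟩ := hn.exists_lift hR
    obtain ⟨L, q, hq, hqL, hint⟩ := ih x.tail p' hp'
    let d : (D R 1 n).obj c := ⟨_, hd⟩
    have hs : (M.chart i).shift p d = p' := Chart.shift_eq _ (add_sub_cancel _ _).symm
    refine ⟨d :: L, q, hq, ?_, ?_⟩
    · rw [List.map_cons, List.sum_cons, hqL, ← add_assoc]
      congr 1
      exact (add_sub_cancel _ _).symm
    · rw [List.map_cons, List.prod_cons, Module.End.mul_apply, FlatTransport.translate_app,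
        integral_succ, map_mul, hint]
      simp only [CategoryTheory.Functor.map_id, types_id_apply]
      rw [hs]
      congr 2
      exact ω.val_congr hp.symm (by rw [hs, hp']) _ _

end OneForm

end Manifold

end SDG

theorem proposition1p2 {C : Type u} [Category.{v} C] (J : GrothendieckTopology C)
    (R : SDG.RingObject.{v, u, w} J) (hR : R.IsLine) (n : ℕ)
    (M : SDG.Manifold.{v, u, w, t} R n)
    (G : SDG.GroupObject.{v, u, w} J) (hG : SDG.GroupObject.IsMatrixGroup R G)
    (ω : M.OneForm G) (hω : ω.IsClosed)
    (c : Cᵒᵖ) (l m : ℕ) (x : M.Path l c) (y : M.Path m c)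
    (hdom : x.domain = y.domain) (hcod : x.codomain = y.codomain) :
    ω.integral x = ω.integral y := by
  obtain ⟨W, j, hW, hj, hinj⟩ := hG
  obtain ⟨S, hS, H⟩ := M.jointly_epic c x.domain
  -- It suffices to compare the integrals on a covering where the starting point lies in a chart.
  refine SDG.sheaf_ext G.carrier hS fun {d} f hf => ?_
  obtain ⟨i, p, hp⟩ := H f hf
  rw [← ω.integral_map, ← ω.integral_map]
  obtain ⟨L, q, hq, hqL, hx⟩ := ω.exists_integral_eq hR hω i hW j hj (x.map f) p hp
  obtain ⟨L', q', hq', hqL', hy⟩ := ω.exists_integral_eq hR hω i hW j hj (y.map f) p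
    (hp.trans (congrArg _ hdom))
  -- The chart is monic, so the common codomain has a single lift and the two displacement sums
  -- agree.
  have hqq : q = q' := (M.chart i).param_injective d
    ((hq.trans (congrArg (M.carrier.obj.map f) hcod)).trans hq'.symm)
  have hL : (L.map SDG.D.coords).sum = (L'.map SDG.D.coords).sum :=
    add_left_cancel (hqL.symm.trans ((congrArg _ hqq).trans hqL'))
  refine hinj d ?_
  rw [hx, hy, SDG.FlatTransport.prod_translate_eq _ hR hW L L' hL]
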